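/- A topological space is *spectral* if it is sober and its compact open subsets are closed under finite intersections and form a base of the topology. For a topological space $Y$, let $VY$ be the set of closed subsets of $Y$ with the topology generated by the sets $\{A\in VY\mid A\cap U\neq\varnothing\}$, $U\subseteq Y$ open. A *spectral distributor* from a spectral space $X$ to a spectral space $Y$ is a relation $r\subseteq X\times Y$ such that $x\mapsto r(x)=\{y\mid x\,r\,y\}$ is a spectral map $X\to VY$, that is, all sets $r(x)$ are closed and this map is continuous with compact preimages of compact open sets. The *underlying order* of a spectral space is given by $x\le y\iff y\in\overline{\{x\}}$. Spectral spaces and spectral distributors form a category, with relational composition and with the underlying order of $X$ as the identity on $X$. A spectral space $X$ is an *Esakia space* if, for every subset $A\subseteq X$ that is open in the patch topology (the topology generated by the open subsets of $X$ and the complements of its compact open subsets), the down-closure $\{x\mid x\le y\text{ for some }y\in A\}$ is open in $X$. Let $\mathsf{EsaDist}$ be the full subcategory of the category of spectral spaces and spectral distributors given by the Esakia spaces, and let $\mathsf{StoneRel}$ be the full subcategory given by the Stone spaces (the zero-dimensional compact Hausdorff spaces); the morphisms of $\mathsf{StoneRel}$ are also called continuous (or Boolean) relations. **Corollary.** Every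 Stone space is an Esakia space, and the inclusion $\mathsf{StoneRel}\hookrightarrow\mathsf{EsaDist}$ exhibits $\mathsf{EsaDist}$ as the idempotent split completion (Karoubi envelope) of $\mathsf{StoneRel}$: there is an equivalence of categories $\mathrm{Kar}(\mathsf{StoneRel})\simeq\mathsf{EsaDist}$ whose composite with the canonical embedding $\mathsf{StoneRel}\to\mathrm{Kar}(\mathsf{StoneRel})$ is naturally isomorphic to the inclusion. -/

import Mathlib

open CategoryTheory TopologicalSpace Topology

universe u

/-- The topology of the lower Vietoris space `VY` on the set of closed subsets of `Y`: it is
generated by the sets `{A | A ∩ U ≠ ∅}` for `U ⊆ Y` open. -/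
@[reducible]
def lowerVietoris (Y : Type*) [TopologicalSpace Y] : TopologicalSpace (Closeds Y) :=
  TopologicalSpace.generateFrom
    {S | ∃ U : Set Y, IsOpen U ∧ S = {A : Closeds Y | ((A : Set Y) ∩ U).Nonempty}}

/-- A relation `r` between spectral spaces `X` and `Y` is a spectral distributor if
`x ↦ {y | r x y}` takes values in the closed subsets of `Y` and is a spectral map from `X` to the
lower Vietoris space `VY`. -/
def IsSpectralDistributor {X Y : Type*} [TopologicalSpace X] [TopologicalSpace Y]
    (r : X → Y → Prop) : Prop :=
  ∃ f : X → Closeds Y, (∀ x y, y ∈ f x ↔ r x y) ∧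
    @IsSpectralMap X (Closeds Y) _ (lowerVietoris Y) f

/-- Relational composition, in diagrammatic order. -/
def relComp {X Y Z : Type*} (r : X → Y → Prop) (s : Y → Z → Prop) (x : X) (z : Z) : Prop :=
  ∃ y, r x y ∧ s y z

/-- The underlying order of a space: `x ≤ y` if and only if `y ∈ closure {x}`. -/
def underlyingOrder (X : Type*) [TopologicalSpace X] (x y : X) : Prop :=
  y ∈ closure {x}

/-- The down-closure of a subset, with respect to the underlying order. -/
def downClosure {X : Type*} [TopologicalSpace X] (A : Set X) : Set X :=
  {x | ∃ y ∈ A, underlyingOrder X x y}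

theorem underlyingOrder_iff {X : Type*} [TopologicalSpace X] (x y : X) :
    underlyingOrder X x y ↔ x ⤳ y :=
  specializes_iff_mem_closure.symm

/-- The set of closed sets that meet a given compact set is compact. -/
theorem isCompact_diamond {Y : Type*} [TopologicalSpace Y] {K : Set Y} (hK : IsCompact K) :
    @IsCompact (Closeds Y) (lowerVietoris Y) {A | ((A : Set Y) ∩ K).Nonempty} := by
  let _ : TopologicalSpace (Closeds Y) := lowerVietoris Y
  have hc : Continuous (fun y : Y => (⟨closure {y}, isClosed_closure⟩ : Closeds Y)) := by
    rw [continuous_generateFrom_iff]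
    rintro _ ⟨U, hU, rfl⟩
    convert hU using 1
    ext y
    constructor
    · rintro ⟨z, hz, hzU⟩
      exact (specializes_iff_mem_closure.2 hz).mem_open hU hzU
    · intro hy
      exact ⟨y, subset_closure rfl, hy⟩
  have hle : ∀ (A : Closeds Y) (y : Y), y ∈ A →
      A ⤳ (⟨closure {y}, isClosed_closure⟩ : Closeds Y) := by
    intro A y hy
    have hl : (nhds (⟨closure {y}, isClosed_closure⟩ : Closeds Y)) = _ :=
      TopologicalSpace.nhds_generateFrom
    rw [Specializes, hl]
    refine le_iInf₂ fun S hS => ?_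
    obtain ⟨hm, U, hU, rfl⟩ := hS
    rw [Filter.le_principal_iff]
    refine IsOpen.mem_nhds (TopologicalSpace.isOpen_generateFrom_of_mem ⟨U, hU, rfl⟩) ?_
    obtain ⟨z, hz, hzU⟩ := hm
    exact ⟨y, hy, (specializes_iff_mem_closure.2 hz).mem_open hU hzU⟩
  refine isCompact_of_finite_subcover fun {ι} V hV hcov => ?_
  obtain ⟨t, ht⟩ := (hK.image hc).elim_finite_subcover V hV (by
    rintro _ ⟨y, hy, rfl⟩
    exact hcov ⟨y, subset_closure rfl, hy⟩)
  refine ⟨t, ?_⟩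
  rintro A ⟨y, hyA, hyK⟩
  have := ht ⟨y, hyK, rfl⟩
  simp only [Set.mem_iUnion] at this ⊢
  obtain ⟨i, hi, hm⟩ := this
  exact ⟨i, hi, (hle A y hyA).mem_open (hV i) hm⟩

/-- A spectral distributor has closed values, and preimages of compact open sets are compact open;
between spectral spaces the converse holds as well. -/
theorem isSpectralDistributor_iff {X Y : Type*} [TopologicalSpace X] [TopologicalSpace Y]
    [SpectralSpace X] [SpectralSpace Y] (r : X → Y → Prop) :
    IsSpectralDistributor r ↔ (∀ x, IsClosed {y | r x y}) ∧
      ∀ U : Set Y, IsOpen U → IsCompact U →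
        IsOpen {x | ∃ y ∈ U, r x y} ∧ IsCompact {x | ∃ y ∈ U, r x y} := by
  let _ : TopologicalSpace (Closeds Y) := lowerVietoris Y
  constructor
  · rintro ⟨f, hf, hs⟩
    refine ⟨fun x => ?_, fun U hU hUc => ?_⟩
    · have : {y | r x y} = (f x : Set Y) := by ext y; exact (hf x y).symm
      rw [this]; exact (f x).isClosed
    · have hpre : {x | ∃ y ∈ U, r x y} = f ⁻¹' {A | ((A : Set Y) ∩ U).Nonempty} := by
        ext x
        constructor
        · rintro ⟨y, hy, h⟩
          exact ⟨y, (hf x y).2 h, hy⟩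
        · rintro ⟨y, h, hy⟩
          exact ⟨y, hy, (hf x y).1 h⟩
      have ho : IsOpen {A : Closeds Y | ((A : Set Y) ∩ U).Nonempty} :=
        TopologicalSpace.isOpen_generateFrom_of_mem ⟨U, hU, rfl⟩
      rw [hpre]
      exact ⟨ho.preimage hs.continuous, hs.isCompact_preimage_of_isOpen ho (isCompact_diamond hUc)⟩
  · rintro ⟨hcl, h⟩
    let f : X → Closeds Y := fun x => ⟨{y | r x y}, hcl x⟩
    let C : Set (Set (Closeds Y)) := {S | ∃ U : Set Y, (IsOpen U ∧ IsCompact U) ∧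
      S = {A : Closeds Y | ((A : Set Y) ∩ U).Nonempty}}
    have hgen : lowerVietoris Y = TopologicalSpace.generateFrom C := by
      apply le_antisymm
      · refine le_generateFrom ?_
        rintro _ ⟨U, hU, rfl⟩
        exact TopologicalSpace.isOpen_generateFrom_of_mem ⟨U, hU.1, rfl⟩
      · refine le_generateFrom ?_
        rintro _ ⟨U, hU, rfl⟩
        have : {A : Closeds Y | ((A : Set Y) ∩ U).Nonempty} =
            ⋃ W ∈ {W : Set Y | (IsOpen W ∧ IsCompact W) ∧ W ⊆ U},
              {A : Closeds Y | ((A : Set Y) ∩ W).Nonempty} := by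
          ext A
          simp only [Set.mem_iUnion]
          constructor
          · rintro ⟨y, hyA, hyU⟩
            obtain ⟨W, hW, hyW, hWU⟩ :=
              PrespectralSpace.isTopologicalBasis.exists_subset_of_mem_open hyU hU
            exact ⟨W, ⟨hW, hWU⟩, y, hyA, hyW⟩
          · rintro ⟨W, ⟨_, hWU⟩, y, hyA, hyW⟩
            exact ⟨y, hyA, hWU hyW⟩
        rw [this]
        refine @isOpen_biUnion _ _ (TopologicalSpace.generateFrom C) _ _ fun W hW => ?_
        exact TopologicalSpace.isOpen_generateFrom_of_mem ⟨W, hW.1, rfl⟩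
    have hpre : ∀ S ∈ C, IsOpen (f ⁻¹' S) ∧ IsCompact (f ⁻¹' S) := by
      rintro _ ⟨U, hU, rfl⟩
      have : f ⁻¹' {A | ((A : Set Y) ∩ U).Nonempty} = {x | ∃ y ∈ U, r x y} := by
        ext x
        constructor
        · rintro ⟨y, h, hy⟩
          exact ⟨y, hy, h⟩
        · rintro ⟨y, hy, h⟩
          exact ⟨y, h, hy⟩
      rw [this]
      exact h U hU.1 hU.2
    have hcont : Continuous f := by
      have : @Continuous X (Closeds Y) _ (TopologicalSpace.generateFrom C) f :=
        continuous_generateFrom_iff.2 fun S hS => (hpre S hS).1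
      rwa [← hgen] at this
    have hfin : ∀ F : Set (Set (Closeds Y)), F.Finite → F ⊆ C →
        IsOpen (f ⁻¹' ⋂₀ F) ∧ IsCompact (f ⁻¹' ⋂₀ F) := by
      intro F hF
      induction F, hF using Set.Finite.induction_on with
      | empty => intro _; simpa using isCompact_univ
      | insert _ _ ih =>
        intro hsub
        rw [Set.insert_subset_iff] at hsub
        rw [Set.sInter_insert, Set.preimage_inter]
        have h1 := hpre _ hsub.1
        have h2 := ih hsub.2
        exact ⟨h1.1.inter h2.1,
          QuasiSeparatedSpace.inter_isCompact _ _ h1.1 h1.2 h2.1 h2.2⟩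
    have hbasis := TopologicalSpace.isTopologicalBasis_of_subbasis hgen
    refine ⟨f, fun x y => Iff.rfl, hcont, fun S hS hSc => ?_⟩
    let 𝒲 : Set (Set (Closeds Y)) :=
      {W | W ∈ (fun F => ⋂₀ F) '' {F : Set (Set (Closeds Y)) | F.Finite ∧ F ⊆ C} ∧ W ⊆ S}
    obtain ⟨T, hT, hTfin, hTcov⟩ := hSc.elim_finite_subcover_image (b := 𝒲) (c := id)
      (fun W hW => hbasis.isOpen hW.1) (by
        intro A hA
        obtain ⟨W, hW, hAW, hWS⟩ := hbasis.exists_subset_of_mem_open hA hS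
        exact Set.mem_biUnion (show W ∈ 𝒲 from ⟨hW, hWS⟩) hAW)
    have hSe : f ⁻¹' S = ⋃ W ∈ T, f ⁻¹' W := by
      ext x
      simp only [Set.mem_iUnion]
      constructor
      · intro hx
        have := hTcov hx
        simp only [Set.mem_iUnion] at this
        obtain ⟨W, hW, hm⟩ := this
        exact ⟨W, hW, hm⟩
      · rintro ⟨W, hW, hm⟩
        exact (hT hW).2 hm
    rw [hSe]
    refine hTfin.isCompact_biUnion fun W hW => ?_
    obtain ⟨⟨F, hF, rfl⟩, -⟩ := hT hW
    exact (hfin F hF.1 hF.2).2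

/-- The underlying order of a spectral space is a spectral distributor. -/
theorem isSpectralDistributor_underlyingOrder (X : Type*) [TopologicalSpace X] [SpectralSpace X] :
    IsSpectralDistributor (underlyingOrder X) := by
  rw [isSpectralDistributor_iff]
  refine ⟨fun x => isClosed_closure, fun U hU hUc => ?_⟩
  have : {x | ∃ y ∈ U, underlyingOrder X x y} = U := by
    ext x
    constructor
    · rintro ⟨y, hy, h⟩
      exact ((underlyingOrder_iff x y).1 h).mem_open hU hy
    · intro hx
      exact ⟨x, hx, subset_closure rfl⟩
  rw [this]
  exact ⟨hU, hUc⟩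

theorem IsSpectralDistributor.down {X Y : Type*} [TopologicalSpace X] [TopologicalSpace Y]
    [SpectralSpace X] [SpectralSpace Y] {r : X → Y → Prop} (hr : IsSpectralDistributor r)
    {x x' : X} {y : Y} (hx : underlyingOrder X x x') (h : r x' y) : r x y := by
  obtain ⟨hcl, ho⟩ := (isSpectralDistributor_iff r).1 hr
  by_contra hn
  obtain ⟨W, hW, hyW, hWU⟩ := PrespectralSpace.isTopologicalBasis.exists_subset_of_mem_open
    (show y ∈ {y | r x y}ᶜ from hn) (hcl x).isOpen_compl
  obtain ⟨z, hz, hxz⟩ := ((underlyingOrder_iff x x').1 hx).mem_open (ho W hW.1 hW.2).1 ⟨y, hyW, h⟩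
  exact hWU hz hxz

theorem IsSpectralDistributor.up {X Y : Type*} [TopologicalSpace X] [TopologicalSpace Y]
    [SpectralSpace X] [SpectralSpace Y] {r : X → Y → Prop} (hr : IsSpectralDistributor r)
    {x : X} {y y' : Y} (h : r x y) (hy : underlyingOrder Y y y') : r x y' :=
  ((underlyingOrder_iff y y').1 hy).mem_closed (((isSpectralDistributor_iff r).1 hr).1 x) h

theorem constructibleTopology_le {X : Type*} [τ : TopologicalSpace X] [PrespectralSpace X] :
    constructibleTopology X ≤ τ := by
  intro U hU
  rw [PrespectralSpace.isTopologicalBasis.open_eq_sUnion' hU]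
  exact @isOpen_sUnion _ (constructibleTopology X) _ fun W hW =>
    hW.1.2.isOpen_constructibleTopology_of_isOpen hW.1.1

/-- The relational composite of spectral distributors between spectral spaces is a spectral
distributor. -/
theorem IsSpectralDistributor.comp {X Y Z : Type*} [TopologicalSpace X] [TopologicalSpace Y]
    [TopologicalSpace Z] [SpectralSpace X] [SpectralSpace Y] [SpectralSpace Z]
    {r : X → Y → Prop} {s : Y → Z → Prop}
    (hr : IsSpectralDistributor r) (hs : IsSpectralDistributor s) :
    IsSpectralDistributor (relComp r s) := by
  rw [isSpectralDistributor_iff] at hr hs ⊢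
  refine ⟨fun x => ?_, fun U hU hUc => ?_⟩
  · rw [← isOpen_compl_iff, PrespectralSpace.isTopologicalBasis.isOpen_iff]
    intro z hz
    by_contra hcon
    push Not at hcon
    have hcomp : @CompactSpace Y (constructibleTopology Y) :=
      @Function.Surjective.compactSpace (WithConstructibleTopology Y) _ _
        (constructibleTopology Y) _ (WithTopology.continuous_ofTopology _) _
        (WithTopology.ofTopology_surjective _)
    have hclosed : IsClosed[constructibleTopology Y] {y | r x y} :=
      (hr.1 x).mono constructibleTopology_le
    let N := {U : Set Z // (IsOpen U ∧ IsCompact U) ∧ z ∈ U}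
    obtain ⟨y, hy, hyN⟩ := @IsCompact.inter_iInter_nonempty Y (constructibleTopology Y) _ N
      (@IsClosed.isCompact Y (constructibleTopology Y) _ hcomp hclosed)
      (fun U => {y | ∃ w ∈ U.1, s y w})
      (fun U => by
        rw [← @isOpen_compl_iff Y _ (constructibleTopology Y)]
        have h := hs.2 U.1 U.2.1.1 U.2.1.2
        exact IsCompact.isOpen_constructibleTopology_of_isClosed (by rw [compl_compl]; exact h.2)
          h.1.isClosed_compl)
      (fun u => by
        have hV : (IsOpen (⋂ U ∈ u, U.1) ∧ IsCompact (⋂ U ∈ u, U.1)) ∧ z ∈ ⋂ U ∈ u, U.1 := by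
          classical
          induction u using Finset.induction_on with
          | empty => simpa using isCompact_univ
          | insert U u _ ih =>
            rw [Finset.set_biInter_insert]
            exact ⟨⟨U.2.1.1.inter ih.1.1,
              QuasiSeparatedSpace.inter_isCompact _ _ U.2.1.1 U.2.1.2 ih.1.1 ih.1.2⟩,
              U.2.2, ih.2⟩
        obtain ⟨w, hw, hw'⟩ := Set.not_subset.1 (hcon _ hV.1 hV.2)
        obtain ⟨y, h1, h2⟩ := not_not.1 hw'
        refine ⟨y, h1, Set.mem_iInter₂.2 fun U hU => ⟨w, Set.mem_iInter₂.1 hw U hU, h2⟩⟩)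
    refine hz ⟨y, hy, ?_⟩
    by_contra hn
    obtain ⟨W, hW, hzW, hWs⟩ := PrespectralSpace.isTopologicalBasis.exists_subset_of_mem_open
      (show z ∈ {w | s y w}ᶜ from hn) (hs.1 y).isOpen_compl
    obtain ⟨w, hw, hyw⟩ := Set.mem_iInter.1 hyN ⟨W, hW, hzW⟩
    exact hWs hw hyw
  · have : {x | ∃ z ∈ U, relComp r s x z} = {x | ∃ y ∈ {y | ∃ z ∈ U, s y z}, r x y} := by
      ext x
      constructor
      · rintro ⟨z, hz, y, h1, h2⟩
        exact ⟨y, ⟨z, hz, h2⟩, h1⟩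
      · rintro ⟨y, ⟨z, hz, h2⟩, h1⟩
        exact ⟨z, hz, y, h1, h2⟩
    rw [this]
    exact hr.2 _ (hs.2 U hU hUc).1 (hs.2 U hU hUc).2

/-- A spectral space `X` is an Esakia space if, for every open subset `A` of its patch space, the
down-closure of `A` is open in `X`. For a spectral space the patch topology is the constructible
topology, generated by the compact open sets and their complements. -/
def IsEsakia (X : Type*) [TopologicalSpace X] : Prop :=
  ∀ A : Set X, IsOpen[constructibleTopology X] A → IsOpen (downClosure A)

/-- A Stone space: a zero-dimensional (equivalently, totally disconnected) compact Hausdorff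
space. -/
def IsStone (X : Type*) [TopologicalSpace X] : Prop :=
  CompactSpace X ∧ T2Space X ∧ TotallyDisconnectedSpace X

/-- Every Stone space is spectral. -/
theorem IsStone.spectralSpace {X : Type*} [TopologicalSpace X] (h : IsStone X) :
    SpectralSpace X := by
  obtain ⟨_, _, _⟩ := h
  have : PrespectralSpace X :=
    .of_isTopologicalBasis isTopologicalBasis_isClopen fun U hU => hU.1.isCompact
  constructor

theorem IsStone.isEsakia {X : Type*} [TopologicalSpace X] (h : IsStone X) : IsEsakia X := by
  obtain ⟨_, _, _⟩ := h
  intro A hA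
  have hle : (inferInstance : TopologicalSpace X) ≤ constructibleTopology X := by
    refine le_generateFrom ?_
    rintro U (hU | hU)
    · exact hU.1
    · exact isClosed_compl_iff.1 hU.2.isClosed
  have : downClosure A = A := by
    ext x
    constructor
    · rintro ⟨y, hy, h⟩
      rw [underlyingOrder_iff, specializes_iff_eq] at h
      exact h ▸ hy
    · intro hx
      exact ⟨x, hx, subset_closure rfl⟩
  rw [this]
  exact hle A hA

/-- The objects of the category of spectral spaces and spectral distributors. -/
structure SpecDist : Type (u + 1) where
  carrier : Type u
  [top : TopologicalSpace carrier]
  [spectral : SpectralSpace carrier]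

attribute [instance] SpecDist.top SpecDist.spectral

/-- Morphisms are spectral distributors. -/
@[ext]
structure SpecDist.Hom (X Y : SpecDist.{u}) : Type u where
  rel : X.carrier → Y.carrier → Prop
  isSpectralDistributor : IsSpectralDistributor rel

/-- The category of spectral spaces and spectral distributors: composition is relational
composition, and the identity of `X` is the underlying order of `X`. -/
instance : Category.{u} SpecDist.{u} where
  Hom := SpecDist.Hom
  id X := ⟨underlyingOrder X.carrier, isSpectralDistributor_underlyingOrder X.carrier⟩
  comp f g := ⟨relComp f.rel g.rel, f.isSpectralDistributor.comp g.isSpectralDistributor⟩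
  id_comp f := SpecDist.Hom.ext <| by
    funext x y
    exact propext ⟨fun ⟨_, h1, h2⟩ => f.isSpectralDistributor.down h1 h2,
      fun h => ⟨x, subset_closure rfl, h⟩⟩
  comp_id f := SpecDist.Hom.ext <| by
    funext x y
    exact propext ⟨fun ⟨_, h1, h2⟩ => f.isSpectralDistributor.up h1 h2,
      fun h => ⟨y, h, subset_closure rfl⟩⟩
  assoc f g h := SpecDist.Hom.ext <| by
    funext x w
    exact propext ⟨fun ⟨z, ⟨y, h1, h2⟩, h3⟩ => ⟨y, h1, z, h2, h3⟩,
      fun ⟨y, h1, z, h2, h3⟩ => ⟨z, ⟨y, h1, h2⟩, h3⟩⟩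

/-- The property of being a Stone space. -/
def SpecDist.stone : ObjectProperty SpecDist.{u} := fun X => IsStone X.carrier

/-- The property of being an Esakia space. -/
def SpecDist.esakia : ObjectProperty SpecDist.{u} := fun X => IsEsakia X.carrier

theorem SpecDist.stone_le_esakia : SpecDist.stone.{u} ≤ SpecDist.esakia.{u} :=
  fun _ h => IsStone.isEsakia h

/-- The category of Stone spaces and continuous relations, that is, spectral distributors between
Stone spaces. -/
abbrev StoneRel : Type (u + 1) := SpecDist.stone.{u}.FullSubcategory

/-- The category of spectral Esakia spaces and spectral distributors. -/
abbrev EsaDist : Type (u + 1) := SpecDist.esakia.{u}.FullSubcategory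

/-- The inclusion of `StoneRel` as a full subcategory of `EsaDist`. -/
abbrev stoneRelToEsaDist : StoneRel.{u} ⥤ EsaDist.{u} :=
  ObjectProperty.ιOfLE SpecDist.stone_le_esakia.{u}

/-!
A fully faithful functor `C ⥤ D` exhibits `D` as the idempotent completion of `C` if every object
of `D` is a retract of an object of `C` and every idempotent of `C` splits in `D`
(`CategoryTheory.exists_karoubi_equivalence`). Both conditions are verified for the inclusion of
Stone spaces into Esakia spaces.

*Esakia spaces are retracts of Stone spaces.* For a spectral space `X`, the patch space is a Stone
space. The underlying order of `X` is a spectral distributor from the patch space to `X`, and,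
if `X` is an Esakia space, also from `X` to the patch space, as the preimages of clopen sets are
their down-closures. The composite through the patch space is the order
itself, which is the identity of `X` (`WithConstructibleTopology.relComp_orderIn_orderOut`).

*Idempotents on Stone spaces split.* An idempotent continuous relation `e` on a Stone space `S` acts
by preimage on the Boolean algebra of clopen sets, as an idempotent operator `d` that preserves
finite unions. The fixed points of `d` form a co-Heyting algebra: suprema are unions, the infimum of
`x` and `y` is `d (x ⊓ y)`, and their difference is `d (x \ y)`. Its space of prime ideals is
spectral, and it is an Esakia space, since the down-closure of `basicOpen a \ basicOpen b` is
`basicOpen (a \ b)` (`PrimeIdealSpace.isEsakia`). Dualizing the inclusion of the fixed points into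
the clopen sets and the corestriction of `d` yields distributors `StoneIdempotent.proj` and
`StoneIdempotent.incl`. That these split `e` follows from compactness of `S`
(`StoneIdempotent.relComp_incl_proj`) and from the prime ideal theorem
(`StoneIdempotent.relComp_proj_incl`).
-/

/-! ### Idempotent completions through a full subcategory -/

namespace CategoryTheory

open Category Idempotents

/-- A fully faithful functor `F : C ⥤ D` exhibits `D` as the idempotent completion of `C` as soon as
idempotents of `C` split in `D` and every object of `D` is a retract of an object coming from `C`.
The equivalence sends a formal image `(X, p)` to a chosen splitting of `F.map p`. -/
theorem exists_karoubi_equivalence {C D : Type*} [Category* C] [Category* D] (F : C ⥤ D)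
    [F.Full] [F.Faithful]
    (split : ∀ (X : C) (p : X ⟶ X), p ≫ p = p →
      ∃ (Y : D) (i : Y ⟶ F.obj X) (r : F.obj X ⟶ Y), i ≫ r = 𝟙 Y ∧ r ≫ i = F.map p)
    (retract : ∀ Y : D, ∃ X : C, Nonempty (Retract Y (F.obj X))) :
    ∃ e : Karoubi C ≌ D, Nonempty (toKaroubi C ⋙ e.functor ≅ F) := by
  choose Y i r hir hri using fun P : Karoubi C => split P.X P.p P.idem
  have hi : ∀ P, i P ≫ F.map P.p = i P := fun P => by rw [← hri, ← assoc, hir, id_comp]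
  have hr : ∀ P, F.map P.p ≫ r P = r P := fun P => by rw [← hri, assoc, hir, comp_id]
  let G : Karoubi C ⥤ D :=
    { obj := Y
      map := fun {P Q} f => i P ≫ F.map f.f ≫ r Q
      map_id := fun P => by rw [Karoubi.id_f, hr, hir]
      map_comp := fun {P Q R} f g => by
        simp only [assoc, Karoubi.comp_f, F.map_comp]
        rw [← assoc (r Q), hri, ← assoc (F.map Q.p), ← F.map_comp, Karoubi.p_comp] }
  -- conjugating back by the splittings recovers the underlying morphism
  have hG : ∀ {P Q : Karoubi C} (f : P ⟶ Q), r P ≫ G.map f ≫ i Q = F.map f.f := fun {P Q} f => by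
    change r P ≫ (i P ≫ F.map f.f ≫ r Q) ≫ i Q = _
    simp only [assoc]
    rw [hri, ← assoc, hri, ← F.map_comp, ← F.map_comp, f.comm]
  have : G.Faithful := ⟨fun {P Q} f g h => by
    ext
    exact F.map_injective (by rw [← hG, ← hG, h])⟩
  have : G.Full := ⟨fun {P Q} g => by
    refine ⟨⟨F.preimage (r P ≫ g ≫ i Q), F.map_injective ?_⟩, ?_⟩
    · simp only [F.map_comp, F.map_preimage, assoc]
      rw [hi, ← assoc, hr]
    · change i P ≫ F.map (F.preimage (r P ≫ g ≫ i Q)) ≫ r Q = g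
      simp only [F.map_preimage, assoc, hir]
      rw [← assoc, hir, id_comp]
      exact comp_id g⟩
  have : G.EssSurj := ⟨fun Z => by
    obtain ⟨X, ⟨ρ⟩⟩ := retract Z
    let P : Karoubi C := ⟨X, F.preimage (ρ.r ≫ ρ.i), F.map_injective (by simp)⟩
    have hP : r P ≫ i P = ρ.r ≫ ρ.i := by rw [hri]; exact F.map_preimage _
    refine ⟨P, ⟨⟨i P ≫ ρ.r, ρ.i ≫ r P, ?_, ?_⟩⟩⟩
    · change (i P ≫ ρ.r) ≫ ρ.i ≫ r P = 𝟙 (Y P)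
      rw [assoc, ← assoc ρ.r, ← hP, assoc, hir, comp_id, hir]
    · rw [assoc, ← assoc (r P), hP]
      simp⟩
  have : G.IsEquivalence := { }
  refine ⟨G.asEquivalence, ⟨NatIso.ofComponents
    (fun X => ⟨i ((toKaroubi C).obj X), r ((toKaroubi C).obj X), hir _,
      (hri ((toKaroubi C).obj X)).trans (F.map_id X)⟩) fun f => ?_⟩⟩
  let f' := (toKaroubi C).map f
  change (i _ ≫ F.map f'.f ≫ r _) ≫ i _ = i _ ≫ F.map f'.f
  rw [assoc, assoc, hri, ← F.map_comp, Karoubi.comp_p]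

end CategoryTheory

/-! ### The prime ideal space of a bounded distributive lattice -/

open Order

/-- The set of prime ideals of a lattice. -/
def PrimeIdealSpace (L : Type*) [Lattice L] : Type _ := {I : Ideal L // I.IsPrime}

namespace PrimeIdealSpace

section Lattice

variable {L : Type*} [Lattice L]

/-- The set of prime ideals that do not contain `a`. -/
def basicOpen (a : L) : Set (PrimeIdealSpace L) := {I | a ∉ I.1}

/-- The spectral (hull-kernel) topology, generated by the basic open sets. -/
instance : TopologicalSpace (PrimeIdealSpace L) :=
  generateFrom (Set.range basicOpen)

theorem isOpen_basicOpen (a : L) : IsOpen (basicOpen a) :=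
  isOpen_generateFrom_of_mem ⟨a, rfl⟩

theorem basicOpen_inf (a b : L) : basicOpen (a ⊓ b) = basicOpen a ∩ basicOpen b := by
  ext I
  refine ⟨fun h => ⟨fun ha => h (I.1.lower inf_le_left ha),
    fun hb => h (I.1.lower inf_le_right hb)⟩, fun h hab => (I.2.mem_or_mem hab).elim h.1 h.2⟩

theorem basicOpen_sup (a b : L) : basicOpen (a ⊔ b) = basicOpen a ∪ basicOpen b := by
  ext I
  simp only [basicOpen, Set.mem_union, Set.mem_ofPred_eq, Ideal.sup_mem_iff]
  tauto

theorem basicOpen_bot [OrderBot L] : basicOpen (⊥ : L) = ∅ := by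
  ext I
  simp [basicOpen]

theorem basicOpen_top [OrderTop L] : basicOpen (⊤ : L) = Set.univ := by
  ext I
  have := I.2.toIsProper
  simp [basicOpen, Ideal.IsProper.top_notMem]

theorem basicOpen_finset_sup [OrderBot L] {ι : Type*} (t : Finset ι) (b : ι → L) :
    basicOpen (t.sup b) = ⋃ i ∈ t, basicOpen (b i) := by
  classical
  induction t using Finset.induction_on with
  | empty => simp [basicOpen_bot]
  | insert i t _ ih => rw [Finset.sup_insert, basicOpen_sup, ih, Finset.set_biUnion_insert]

theorem isTopologicalBasis_basicOpen [OrderTop L] :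
    IsTopologicalBasis (Set.range (basicOpen (L := L))) where
  exists_subset_inter := by
    rintro _ ⟨a, rfl⟩ _ ⟨b, rfl⟩ I hI
    exact ⟨_, ⟨a ⊓ b, rfl⟩, by rwa [basicOpen_inf], (basicOpen_inf a b).subset⟩
  sUnion_eq := Set.eq_univ_of_univ_subset
    (Set.subset_sUnion_of_subset _ _ subset_rfl ⟨⊤, basicOpen_top⟩)
  eq_generateFrom := rfl

/-- The underlying order of the prime ideal space is inclusion of ideals. -/
theorem underlyingOrder_iff_le [OrderTop L] {I J : PrimeIdealSpace L} :
    underlyingOrder (PrimeIdealSpace L) I J ↔ I.1 ≤ J.1 := by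
  rw [underlyingOrder, isTopologicalBasis_basicOpen.mem_closure_iff]
  simp only [Set.forall_mem_range, Set.inter_singleton_nonempty]
  exact forall_congr' fun a => not_imp_not

end Lattice

section DistribLattice

variable {L : Type*} [DistribLattice L]

/-- The prime ideal theorem: a filter and an ideal that are disjoint are separated by a point. -/
theorem exists_of_disjoint (F : PFilter L) (I : Ideal L) (h : ∀ a ∈ F, a ∉ I) :
    ∃ J : PrimeIdealSpace L, I ≤ J.1 ∧ ∀ a ∈ F, a ∉ J.1 := by
  obtain ⟨J, hJ, hIJ, hFJ⟩ := DistribLattice.prime_ideal_of_disjoint_filter_ideal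
    (F := F) (I := I) (Set.disjoint_left.2 h)
  exact ⟨⟨J, hJ⟩, hIJ, fun a ha => Set.disjoint_left.1 hFJ ha⟩

theorem exists_of_notMem {a : L} {I : Ideal L} (h : a ∉ I) :
    ∃ J : PrimeIdealSpace L, I ≤ J.1 ∧ a ∉ J.1 := by
  obtain ⟨J, hIJ, hJ⟩ := exists_of_disjoint (PFilter.principal a) I
    fun b hb hbI => h (I.lower (PFilter.mem_principal.1 hb) hbI)
  exact ⟨J, hIJ, hJ a (PFilter.mem_principal.2 le_rfl)⟩

variable [BoundedOrder L]

/-- If finitely many elements of `P` never cover `a`, then a prime ideal containing the ideal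
generated by `P`, but not `a`, is a point of `basicOpen a` outside all the sets in the cover. -/
theorem isCompact_basicOpen (a : L) : IsCompact (basicOpen a) := by
  refine isCompact_generateFrom rfl fun P hP hcov => ?_
  let I : Ideal L :=
    { carrier := {c | ∃ t : Finset L, (∀ b ∈ t, basicOpen b ∈ P) ∧ c ≤ t.sup id}
      lower' := fun c c' hc ⟨t, ht, h⟩ => ⟨t, ht, hc.trans h⟩
      nonempty' := ⟨⊥, ∅, by simp⟩
      directed' := by
        classical
        rintro c ⟨t, ht, hc⟩ c' ⟨t', ht', hc'⟩
        refine ⟨c ⊔ c', ⟨t ∪ t', fun b hb => ?_, ?_⟩, le_sup_left, le_sup_right⟩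
        · exact (Finset.mem_union.1 hb).elim (ht b) (ht' b)
        · rw [Finset.sup_union]
          exact sup_le_sup hc hc' }
  have haI : a ∈ I := by
    by_contra haI
    obtain ⟨J, hIJ, haJ⟩ := exists_of_notMem haI
    obtain ⟨U, hU, hJU⟩ := hcov haJ
    obtain ⟨b, rfl⟩ := hP hU
    exact hJU (hIJ ⟨{b}, by simpa using hU, by simp⟩)
  obtain ⟨t, ht, hat⟩ := haI
  refine ⟨basicOpen '' t, ?_, t.finite_toSet.image _, fun J hJ => ?_⟩
  · rintro _ ⟨b, hb, rfl⟩
    exact ht b hb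
  · have : J ∈ basicOpen (t.sup id) := fun h => hJ (J.1.lower hat h)
    simpa [basicOpen_finset_sup] using this

theorem isOpen_and_isCompact_iff {U : Set (PrimeIdealSpace L)} :
    IsOpen U ∧ IsCompact U ↔ ∃ a, U = basicOpen a := by
  refine ⟨fun ⟨hU, hUc⟩ => ?_, fun ⟨a, ha⟩ => ha ▸ ⟨isOpen_basicOpen a, isCompact_basicOpen a⟩⟩
  obtain ⟨s, hs, rfl⟩ := eq_finite_iUnion_of_isTopologicalBasis_of_isCompact_open basicOpen
    isTopologicalBasis_basicOpen U hUc hU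
  refine ⟨hs.toFinset.sup id, ?_⟩
  rw [basicOpen_finset_sup]
  simp

instance : SpectralSpace (PrimeIdealSpace L) :=
  have : PrespectralSpace (PrimeIdealSpace L) :=
    .of_isTopologicalBasis' isTopologicalBasis_basicOpen isCompact_basicOpen
  have : T0Space (PrimeIdealSpace L) := ⟨fun I J h => Subtype.ext <| le_antisymm
    (underlyingOrder_iff_le.1 ((underlyingOrder_iff I J).2 h.specializes))
    (underlyingOrder_iff_le.1 ((underlyingOrder_iff J I).2 h.specializes'))⟩
  have : CompactSpace (PrimeIdealSpace L) :=
    ⟨by rw [← basicOpen_top]; exact isCompact_basicOpen ⊤⟩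
  have : QuasiSeparatedSpace (PrimeIdealSpace L) := ⟨fun U V hU hUc hV hVc => by
    obtain ⟨a, rfl⟩ := isOpen_and_isCompact_iff.1 ⟨hU, hUc⟩
    obtain ⟨b, rfl⟩ := isOpen_and_isCompact_iff.1 ⟨hV, hVc⟩
    rw [← basicOpen_inf]
    exact isCompact_basicOpen _⟩
  have : QuasiSober (PrimeIdealSpace L) := ⟨fun {Z} hZ hZc => by
    -- the generic point consists of the elements whose basic open set misses `Z`
    let I : Ideal L :=
      { carrier := {a | ∀ J ∈ Z, a ∈ J.1}
        lower' := fun a b hab ha J hJ => J.1.lower hab (ha J hJ)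
        nonempty' := ⟨⊥, fun J _ => J.1.bot_mem⟩
        directed' := fun a ha b hb =>
          ⟨a ⊔ b, fun J hJ => J.1.sup_mem (ha J hJ) (hb J hJ), le_sup_left, le_sup_right⟩ }
    have hI : ∀ a, a ∉ I ↔ (Z ∩ basicOpen a).Nonempty := fun a => by
      change (¬ ∀ J ∈ Z, a ∈ J.1) ↔ _
      push Not
      rfl
    have hIp : I.IsProper := Ideal.isProper_of_notMem (p := ⊤) <| (hI ⊤).2 <| by
      rw [basicOpen_top, Set.inter_univ]
      exact hZ.nonempty
    have hprime : I.IsPrime := .of_mem_or_mem fun {a b} hab => by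
      by_contra! h
      refine (hI (a ⊓ b)).2 ?_ hab
      rw [basicOpen_inf]
      exact hZ.isPreirreducible _ _ (isOpen_basicOpen a) (isOpen_basicOpen b)
        ((hI a).1 h.1) ((hI b).1 h.2)
    let G : PrimeIdealSpace L := ⟨I, hprime⟩
    refine ⟨G, Set.Subset.antisymm (hZc.closure_subset_iff.2 (Set.singleton_subset_iff.2 ?_))
      fun J hJ => ?_⟩
    · rw [← hZc.closure_eq, isTopologicalBasis_basicOpen.mem_closure_iff]
      rintro _ ⟨a, rfl⟩ ha
      rw [Set.inter_comm]
      exact (hI a).1 ha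
    · exact underlyingOrder_iff_le.2 fun a ha => ha J hJ⟩
  { }

end DistribLattice

/-- In a co-Heyting algebra, the down-closure of `basicOpen a \ basicOpen b` is
`basicOpen (a \ b)`. -/
theorem downClosure_basicOpen_diff {L : Type*} [CoheytingAlgebra L] (a b : L) :
    downClosure (basicOpen a \ basicOpen b) = basicOpen (a \ b) := by
  ext I
  constructor
  · rintro ⟨J, ⟨haJ, hbJ⟩, hIJ⟩ hI
    exact haJ (J.1.lower le_sup_sdiff
      (J.1.sup_mem (not_not.1 hbJ) (underlyingOrder_iff_le.1 hIJ hI)))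
  · intro hI
    have ha : a ∉ I.1 ⊔ Ideal.principal b := by
      rw [Lattice.mem_ideal_sup_principal]
      rintro ⟨c, hc, hac⟩
      exact hI (I.1.lower (sdiff_le_iff'.2 hac) hc)
    obtain ⟨J, hJ, haJ⟩ := exists_of_notMem ha
    refine ⟨J, ⟨haJ, not_not.2 (hJ ?_)⟩, underlyingOrder_iff_le.2 (le_sup_left.trans hJ)⟩
    exact (le_sup_right : _ ≤ I.1 ⊔ Ideal.principal b) Ideal.mem_principal_self

theorem isEsakia {L : Type*} [CoheytingAlgebra L] : IsEsakia (PrimeIdealSpace L) := by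
  -- the differences of basic open sets form a basis of the patch topology
  have hbasis : ∀ A : Set (PrimeIdealSpace L), IsOpen[constructibleTopology _] A →
      ∀ I ∈ A, ∃ a b, I ∈ basicOpen a \ basicOpen b ∧ basicOpen a \ basicOpen b ⊆ A := by
    intro A hA
    induction hA with
    | basic U hU =>
      intro I hI
      rcases hU with hU | hU
      · obtain ⟨a, rfl⟩ := isOpen_and_isCompact_iff.1 hU
        exact ⟨a, ⊥, by simpa [basicOpen_bot] using hI, Set.sdiff_subset⟩
      · obtain ⟨a, ha⟩ := isOpen_and_isCompact_iff.1 ⟨hU.1.isOpen_compl, hU.2⟩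
        refine ⟨⊤, a, ?_, ?_⟩
        · rw [basicOpen_top, ← ha]
          simpa using hI
        · rw [basicOpen_top, ← ha]
          simp
    | univ => exact fun I _ => ⟨⊤, ⊥, by simp [basicOpen_top, basicOpen_bot]⟩
    | inter U V _ _ ihU ihV =>
      rintro I ⟨hIU, hIV⟩
      obtain ⟨a, b, hI, hab⟩ := ihU I hIU
      obtain ⟨c, d, hI', hcd⟩ := ihV I hIV
      refine ⟨a ⊓ c, b ⊔ d, ?_⟩
      rw [basicOpen_inf, basicOpen_sup]
      exact ⟨⟨⟨hI.1, hI'.1⟩, fun h => h.elim hI.2 hI'.2⟩, fun J hJ =>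
        ⟨hab ⟨hJ.1.1, fun h => hJ.2 (.inl h)⟩, hcd ⟨hJ.1.2, fun h => hJ.2 (.inr h)⟩⟩⟩
    | sUnion S _ ih =>
      rintro I ⟨U, hU, hIU⟩
      obtain ⟨a, b, hI, hab⟩ := ih U hU I hIU
      exact ⟨a, b, hI, hab.trans (Set.subset_sUnion_of_mem hU)⟩
  intro A hA
  refine isOpen_iff_forall_mem_open.2 fun I => ?_
  rintro ⟨J, hJ, hIJ⟩
  obtain ⟨a, b, hJab, hab⟩ := hbasis A hA J hJ
  refine ⟨basicOpen (a \ b), ?_, isOpen_basicOpen _, ?_⟩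
  · rw [← downClosure_basicOpen_diff]
    exact fun K ⟨K', hK', hKK'⟩ => ⟨K', hab hK', hKK'⟩
  · rw [← downClosure_basicOpen_diff]
    exact ⟨J, hJab, hIJ⟩

end PrimeIdealSpace

/-! ### Fixed points of an idempotent operator on a Boolean algebra -/

/-- An idempotent operator on `B` that preserves finite suprema. -/
structure IdempotentOperator (B : Type*) [Lattice B] [OrderBot B] extends SupBotHom B B where
  idem' : ∀ b, toFun (toFun b) = toFun b

namespace IdempotentOperator

section Lattice

variable {B : Type*} [Lattice B] [OrderBot B]

instance : CoeFun (IdempotentOperator B) fun _ => B → B := ⟨fun d => d.toFun⟩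

variable (d : IdempotentOperator B)

theorem idem (b : B) : d (d b) = d b := d.idem' b

theorem sup (a b : B) : d (a ⊔ b) = d a ⊔ d b := d.map_sup' a b

theorem bot : d ⊥ = ⊥ := d.map_bot'

theorem mono {a b : B} (h : a ≤ b) : d a ≤ d b :=
  sup_eq_right.1 (by rw [← d.sup, sup_eq_right.2 h])

/-- The fixed points of `d`, ordered as in `B`. -/
def FixedPoints : Type _ := {b : B // d b = b}

instance : PartialOrder d.FixedPoints := inferInstanceAs (PartialOrder {b : B // d b = b})

/-- The fixed point `d b`. -/
def toFixedPoints (b : B) : d.FixedPoints := ⟨d b, d.idem b⟩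

theorem toFixedPoints_val (x : d.FixedPoints) : d.toFixedPoints x.1 = x := Subtype.ext x.2

/-- Suprema of fixed points are computed in `B`; the infimum of `x` and `y` is `d (x ⊓ y)`. -/
instance : Lattice d.FixedPoints where
  sup x y := ⟨x.1 ⊔ y.1, by rw [d.sup, x.2, y.2]⟩
  le_sup_left x y := (le_sup_left : x.1 ≤ x.1 ⊔ y.1)
  le_sup_right x y := (le_sup_right : y.1 ≤ x.1 ⊔ y.1)
  sup_le x y z h h' := sup_le (α := B) h h'
  inf x y := d.toFixedPoints (x.1 ⊓ y.1)
  inf_le_left x y := (d.mono inf_le_left).trans_eq x.2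
  inf_le_right x y := (d.mono inf_le_right).trans_eq y.2
  le_inf x y z h h' := x.2.symm.trans_le (d.mono (le_inf h h'))

theorem toFixedPoints_mono {a b : B} (h : a ≤ b) : d.toFixedPoints a ≤ d.toFixedPoints b :=
  d.mono h

theorem toFixedPoints_sup (a b : B) :
    d.toFixedPoints (a ⊔ b) = d.toFixedPoints a ⊔ d.toFixedPoints b := Subtype.ext (d.sup a b)

end Lattice

variable {B : Type*} [BooleanAlgebra B] (d : IdempotentOperator B)

/-- The fixed points of an idempotent operator on a Boolean algebra form a co-Heyting algebra: the
difference of `x` and `y` is `d (x \ y)`. In particular, the lattice of fixed points is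
distributive. -/
instance : CoheytingAlgebra d.FixedPoints where
  top := d.toFixedPoints ⊤
  le_top x := x.2.symm.trans_le (d.mono le_top)
  bot := ⟨⊥, d.bot⟩
  bot_le x := (bot_le : ⊥ ≤ x.1)
  sdiff x y := d.toFixedPoints (x.1 \ y.1)
  hnot x := d.toFixedPoints ((d.toFixedPoints ⊤).1 \ x.1)
  sdiff_le_iff x y z := by
    change d (x.1 \ y.1) ≤ z.1 ↔ x.1 ≤ y.1 ⊔ z.1
    constructor
    · intro h
      calc x.1 = d x.1 := x.2.symm
        _ ≤ d (y.1 ⊔ x.1 \ y.1) := d.mono le_sup_sdiff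
        _ = y.1 ⊔ d (x.1 \ y.1) := by rw [d.sup, y.2]
        _ ≤ y.1 ⊔ z.1 := sup_le_sup_left h _
    · intro h
      exact (d.mono (sdiff_le_iff.2 h)).trans_eq z.2
  top_sdiff _ := rfl

theorem toFixedPoints_bot : d.toFixedPoints ⊥ = ⊥ := Subtype.ext d.bot

end IdempotentOperator

/-! ### Splitting idempotent relations on Stone spaces -/

namespace StoneIdempotent

open Order

variable {S : Type*} [TopologicalSpace S] {e : S → S → Prop}

theorem isOpen_and_isCompact_iff_isClopen [CompactSpace S] [T2Space S] {U : Set S} :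
    IsOpen U ∧ IsCompact U ↔ IsClopen U :=
  ⟨fun h => ⟨h.2.isClosed, h.1⟩, fun h => ⟨h.2, h.1.isCompact⟩⟩

theorem isSpectralDistributor_iff_isClopen_left {X : Type*} [TopologicalSpace X] [SpectralSpace X]
    [SpectralSpace S] [T2Space S] {r : S → X → Prop} :
    IsSpectralDistributor r ↔ (∀ s, IsClosed {x | r s x}) ∧
      ∀ U : Set X, IsOpen U → IsCompact U → IsClopen {s | ∃ x ∈ U, r s x} := by
  simp only [isSpectralDistributor_iff, isOpen_and_isCompact_iff_isClopen]

theorem isSpectralDistributor_iff_isClopen_right {X : Type*} [TopologicalSpace X] [SpectralSpace X]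
    [SpectralSpace S] [T2Space S] {r : X → S → Prop} :
    IsSpectralDistributor r ↔ (∀ x, IsClosed {s | r x s}) ∧ ∀ U : Clopens S,
      IsOpen {x | ∃ s ∈ U, r x s} ∧ IsCompact {x | ∃ s ∈ U, r x s} := by
  rw [isSpectralDistributor_iff]
  refine and_congr_right fun _ => ⟨fun h U => h U U.isClopen.2 U.isClopen.1.isCompact,
    fun h U hU hUc => h ⟨U, isOpen_and_isCompact_iff_isClopen.1 ⟨hU, hUc⟩⟩⟩

variable [SpectralSpace S] [T2Space S]

/-- The operator on clopen sets that sends `U` to its preimage under an idempotent continuous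
relation. -/
def preimage (he : IsSpectralDistributor e) (hee : relComp e e = e) :
    IdempotentOperator (Clopens S) where
  toFun U := ⟨{s | ∃ t ∈ U, e s t},
    (isSpectralDistributor_iff_isClopen_left.1 he).2 U U.isClopen.2 U.isClopen.1.isCompact⟩
  map_sup' U V := by
    ext s
    change (∃ t, (t ∈ U ∨ t ∈ V) ∧ e s t) ↔ (∃ t, t ∈ U ∧ e s t) ∨ (∃ t, t ∈ V ∧ e s t)
    simp only [or_and_right, exists_or]
  map_bot' := by
    ext s
    exact ⟨fun ⟨_, h, _⟩ => h, fun h => h.elim⟩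
  idem' U := by
    ext s
    change (∃ t, (∃ u, u ∈ U ∧ e t u) ∧ e s t) ↔ ∃ u, u ∈ U ∧ e s u
    constructor
    · rintro ⟨t, ⟨u, hu, htu⟩, hst⟩
      exact ⟨u, hu, hee ▸ ⟨t, hst, htu⟩⟩
    · rintro ⟨u, hu, hsu⟩
      rw [← hee] at hsu
      obtain ⟨t, hst, htu⟩ := hsu
      exact ⟨t, ⟨u, hu, htu⟩, hst⟩

variable (he : IsSpectralDistributor e) (hee : relComp e e = e)

/-- The space through which the idempotent relation `e` splits: the prime ideals of the lattice of
clopen sets fixed by the preimage operator of `e`. -/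
abbrev Splitting : Type _ := PrimeIdealSpace (preimage he hee).FixedPoints

/-- The projection onto the splitting. It is dual to the inclusion of the fixed points into the
clopen sets. -/
def proj (s : S) (I : Splitting he hee) : Prop := ∀ a, a ∉ I.1 → s ∈ a.1

/-- The inclusion of the splitting. It is dual to the corestriction of the preimage operator to its
fixed points. -/
def incl (I : Splitting he hee) (s : S) : Prop :=
  ∀ U : Clopens S, s ∈ U → (preimage he hee).toFixedPoints U ∉ I.1

/-- The ideal of fixed points that do not contain `s`. -/
def idealOf (s : S) : Ideal (preimage he hee).FixedPoints where
  carrier := {a | s ∉ a.1}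
  lower' := fun _ _ hab ha hb => ha (hab hb)
  nonempty' := ⟨⊥, fun h => h⟩
  directed' := fun a ha b hb => ⟨a ⊔ b, fun h => h.elim ha hb, le_sup_left, le_sup_right⟩

theorem proj_iff {s : S} {I : Splitting he hee} : proj he hee s I ↔ idealOf he hee s ≤ I.1 :=
  forall_congr' fun _ => not_imp_comm

/-- The preimage of `basicOpen a` is the clopen set `a`, by the prime ideal theorem. -/
theorem isSpectralDistributor_proj : IsSpectralDistributor (proj he hee) := by
  rw [isSpectralDistributor_iff_isClopen_left]
  refine ⟨fun s => ?_, fun V hV hVc => ?_⟩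
  · have : {I | proj he hee s I} =
        ⋂ a ∈ {a | a ∈ idealOf he hee s}, (PrimeIdealSpace.basicOpen a)ᶜ := by
      ext I
      rw [Set.mem_ofPred_eq, proj_iff]
      simp only [Set.mem_iInter]
      exact forall₂_congr fun a _ => not_not.symm
    rw [this]
    exact isClosed_biInter fun a _ => (PrimeIdealSpace.isOpen_basicOpen a).isClosed_compl
  · obtain ⟨a, rfl⟩ := PrimeIdealSpace.isOpen_and_isCompact_iff.1 ⟨hV, hVc⟩
    convert a.1.isClopen using 1
    ext s
    constructor
    · rintro ⟨I, haI, hsI⟩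
      exact hsI a haI
    · intro hs
      obtain ⟨I, hI, haI⟩ :=
        PrimeIdealSpace.exists_of_notMem (a := a) (I := idealOf he hee s) fun h => h hs
      exact ⟨I, haI, (proj_iff he hee).2 hI⟩

/-- If no clopen set whose preimage lies in `I` covers the closed set `K`, then `I` is related to a
point of `K`: otherwise, by compactness, finitely many such clopen sets would cover `K`, and they
are closed under finite unions. -/
theorem exists_incl {I : Splitting he hee} {K : Set S} (hK : IsClosed K)
    (h : ∀ U : Clopens S, K ⊆ U → (preimage he hee).toFixedPoints U ∉ I.1) :
    ∃ s ∈ K, incl he hee I s := by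
  by_contra! hcon
  simp only [incl, not_forall, not_not] at hcon
  choose! U hsU hU using hcon
  obtain ⟨t, ht, htK⟩ := hK.isCompact.elim_nhds_subcover (fun s => (U s : Set S))
    fun s hs => (U s).isClopen.2.mem_nhds (hsU s hs)
  suffices ∃ V : Clopens S, (⋃ s ∈ t, (U s : Set S)) ⊆ V ∧
      (preimage he hee).toFixedPoints V ∈ I.1 from
    this.elim fun V hV => h V (htK.trans hV.1) hV.2
  clear htK
  classical
  induction t using Finset.induction_on with
  | empty =>
    refine ⟨⊥, by simp, ?_⟩
    rw [IdempotentOperator.toFixedPoints_bot]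
    exact I.1.bot_mem
  | insert s t _ ih =>
    obtain ⟨V, hV, hVI⟩ := ih fun x hx => ht x (Finset.mem_insert_of_mem hx)
    refine ⟨U s ⊔ V, ?_, ?_⟩
    · rw [Finset.set_biUnion_insert]
      exact Set.union_subset_union_right _ hV
    · rw [IdempotentOperator.toFixedPoints_sup]
      exact I.1.sup_mem (hU s (ht s (Finset.mem_insert_self _ _))) hVI

/-- The preimage of a clopen set `U` is the basic open set of the fixed point `e⁻¹(U)`. -/
theorem isSpectralDistributor_incl : IsSpectralDistributor (incl he hee) := by
  rw [isSpectralDistributor_iff_isClopen_right]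
  refine ⟨fun I => ?_, fun U => ?_⟩
  · have : {s | incl he hee I s} =
        ⋂ U ∈ {U : Clopens S | (preimage he hee).toFixedPoints U ∈ I.1}, (U : Set S)ᶜ := by
      ext s
      simp only [Set.mem_iInter]
      exact forall_congr' fun U => imp_not_comm
    rw [this]
    exact isClosed_biInter fun U _ => U.isClopen.2.isClosed_compl
  · rw [PrimeIdealSpace.isOpen_and_isCompact_iff]
    refine ⟨(preimage he hee).toFixedPoints U, Set.ext fun I => ⟨?_, fun hI => ?_⟩⟩
    · rintro ⟨s, hs, hIs⟩
      exact hIs U hs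
    · exact exists_incl he hee U.isClopen.1
        fun V hV h => hI (I.1.lower ((preimage he hee).toFixedPoints_mono hV) h)

theorem relComp_incl_proj :
    relComp (incl he hee) (proj he hee) = underlyingOrder (Splitting he hee) := by
  funext I J
  refine propext (Iff.trans ?_ PrimeIdealSpace.underlyingOrder_iff_le.symm)
  constructor
  · rintro ⟨s, hIs, hsJ⟩ a haI
    by_contra haJ
    have := hIs a.1 (hsJ a haJ)
    rw [IdempotentOperator.toFixedPoints_val] at this
    exact this haI
  · intro hIJ
    -- `proj s J` holds exactly if `s` lies in every fixed point outside `J`; by compactness, a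
    -- clopen set that contains all these `s` already contains one of the fixed points
    suffices ∃ s ∈ ⋂ a ∈ {a | a ∉ J.1}, (a.1 : Set S), incl he hee I s from
      this.elim fun s hs => ⟨s, hs.2, fun a ha => Set.mem_iInter₂.1 hs.1 a ha⟩
    refine exists_incl he hee (isClosed_biInter fun a _ => a.1.isClopen.1) fun U hU hUI => ?_
    have hne : {a | a ∉ J.1}.Nonempty := ⟨⊤, J.2.toIsProper.top_notMem⟩
    obtain ⟨a, ha, haU⟩ : ∃ a, a ∉ J.1 ∧ (a.1 : Set S) ⊆ U := by
      have := hne.to_subtype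
      rw [Set.biInter_eq_iInter] at hU
      obtain ⟨a, ha⟩ := exists_subset_nhds_of_isCompact
        (V := fun a : {a | a ∉ J.1} => (a.1.1 : Set S))
        (fun a b => ⟨⟨a.1 ⊓ b.1, fun h => (J.2.mem_or_mem h).elim a.2 b.2⟩,
          (inf_le_left : a.1 ⊓ b.1 ≤ a.1), (inf_le_right : a.1 ⊓ b.1 ≤ b.1)⟩)
        (fun a => a.1.1.isClopen.1.isCompact) (U := U)
        fun s hs => U.isClopen.2.mem_nhds (hU hs)
      exact ⟨a.1, a.2, ha⟩
    refine ha (hIJ (I.1.lower ?_ hUI))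
    rw [← IdempotentOperator.toFixedPoints_val _ a]
    exact (preimage he hee).toFixedPoints_mono haU

theorem relComp_proj_incl : relComp (proj he hee) (incl he hee) = e := by
  funext s t
  refine propext ⟨?_, fun hst => ?_⟩
  · rintro ⟨I, hsI, hIt⟩
    by_contra hst
    obtain ⟨U, hU, htU, hUe⟩ := PrespectralSpace.isTopologicalBasis.exists_subset_of_mem_open
      (show t ∈ {t | e s t}ᶜ from hst) (((isSpectralDistributor_iff e).1 he).1 s).isOpen_compl
    obtain ⟨u, hu, hsu⟩ :=
      hsI _ (hIt ⟨U, isOpen_and_isCompact_iff_isClopen.1 hU⟩ htU)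
    exact hUe hu hsu
  · -- separate the filter of preimages of neighbourhoods of `t` from the ideal of `s`
    let F : PFilter (preimage he hee).FixedPoints := IsPFilter.toPFilter
      (F := {a | ∃ U : Clopens S, t ∈ U ∧ (preimage he hee).toFixedPoints U ≤ a}) <| by
        refine .of_def ⟨⊤, ⊤, trivial, le_top⟩ ?_ fun {a b} hab => ?_
        · rintro a ⟨U, hU, ha⟩ b ⟨V, hV, hb⟩
          refine ⟨(preimage he hee).toFixedPoints (U ⊓ V), ⟨U ⊓ V, ⟨hU, hV⟩, le_rfl⟩, ?_, ?_⟩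
          · exact ((preimage he hee).toFixedPoints_mono inf_le_left).trans ha
          · exact ((preimage he hee).toFixedPoints_mono inf_le_right).trans hb
        · rintro ⟨U, hU, ha⟩
          exact ⟨U, hU, ha.trans hab⟩
    obtain ⟨I, hI, hFI⟩ := PrimeIdealSpace.exists_of_disjoint F (idealOf he hee s)
      fun a ⟨U, htU, hUa⟩ hsa => hsa (hUa ⟨t, htU, hst⟩)
    exact ⟨I, (proj_iff he hee).2 hI, fun U htU => hFI _ ⟨U, htU, le_rfl⟩⟩

end StoneIdempotent

/-! ### Esakia spaces as retracts of their patch spaces -/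

namespace WithConstructibleTopology

variable (X : Type*) [TopologicalSpace X]

/-- The underlying order of `X`, as a relation from the patch space to `X`. -/
def orderOut (w : WithConstructibleTopology X) (x : X) : Prop :=
  underlyingOrder X (WithTopology.ofTopology w) x

/-- The underlying order of `X`, as a relation from `X` to the patch space. -/
def orderIn (x : X) (w : WithConstructibleTopology X) : Prop :=
  underlyingOrder X x (WithTopology.ofTopology w)

theorem relComp_orderIn_orderOut : relComp (orderIn X) (orderOut X) = underlyingOrder X := by
  funext x y
  refine propext ⟨fun ⟨w, hw, hw'⟩ => ?_, fun h => ⟨WithTopology.toTopology _ x, ?_, h⟩⟩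
  · exact (underlyingOrder_iff x y).2
      (((underlyingOrder_iff _ _).1 hw).trans ((underlyingOrder_iff _ _).1 hw'))
  · exact subset_closure rfl

variable {X} in
theorem isClopen_preimage_ofTopology {U : Set X} (hU : IsOpen U) (hUc : IsCompact U) :
    IsClopen (WithTopology.ofTopology ⁻¹' U : Set (WithConstructibleTopology X)) := by
  refine ⟨isOpen_compl_iff.1 ?_, ?_⟩ <;> rw [WithConstructibleTopology.isOpen_iff]
  · exact IsCompact.isOpen_constructibleTopology_of_isClosed (s := Uᶜ) (by rwa [compl_compl])
      hU.isClosed_compl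
  · exact hUc.isOpen_constructibleTopology_of_isOpen hU

variable [SpectralSpace X]

/-- In a `T0` space with a basis of compact open sets, two points are separated by a compact open
set, and this set is clopen in the patch topology. -/
instance : TotallySeparatedSpace (WithConstructibleTopology X) := by
  rw [totallySeparatedSpace_iff_exists_isClopen]
  intro x y hxy
  by_cases h : WithTopology.ofTopology x ⤳ WithTopology.ofTopology y
  · have h' : ¬ WithTopology.ofTopology y ⤳ WithTopology.ofTopology x := fun h' =>
      hxy (WithTopology.ofTopology_injective _ (h.antisymm h').eq)
    obtain ⟨V, hV, hxV, hyV⟩ := not_specializes_iff_exists_open.1 h'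
    obtain ⟨U, hU, hxU, hUV⟩ :=
      PrespectralSpace.isTopologicalBasis.exists_subset_of_mem_open hxV hV
    exact ⟨_, isClopen_preimage_ofTopology hU.1 hU.2, hxU, fun hy => hyV (hUV hy)⟩
  · obtain ⟨V, hV, hyV, hxV⟩ := not_specializes_iff_exists_open.1 h
    obtain ⟨U, hU, hyU, hUV⟩ :=
      PrespectralSpace.isTopologicalBasis.exists_subset_of_mem_open hyV hV
    exact ⟨_, (isClopen_preimage_ofTopology hU.1 hU.2).compl, fun hx => hxV (hUV hx),
      not_not.2 hyU⟩

theorem isStone : IsStone (WithConstructibleTopology X) :=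
  ⟨inferInstance, inferInstance, inferInstance⟩

instance : SpectralSpace (WithConstructibleTopology X) := (isStone X).spectralSpace

theorem continuous_ofTopology :
    Continuous (WithTopology.ofTopology : WithConstructibleTopology X → X) :=
  continuous_le_rng constructibleTopology_le
    (@WithTopology.continuous_ofTopology X (constructibleTopology X))

variable {X}

theorem isSpectralDistributor_orderOut : IsSpectralDistributor (orderOut X) := by
  rw [isSpectralDistributor_iff]
  refine ⟨fun w => isClosed_closure, fun U hU hUc => ?_⟩
  have h : {w | ∃ x ∈ U, orderOut X w x} =
      (WithTopology.ofTopology ⁻¹' U : Set (WithConstructibleTopology X)) := by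
    ext w
    constructor
    · rintro ⟨x, hx, h⟩
      exact ((underlyingOrder_iff _ x).1 h).mem_open hU hx
    · intro hw
      exact ⟨_, hw, subset_closure rfl⟩
  have hU' := isClopen_preimage_ofTopology hU hUc
  rw [h]
  exact ⟨hU'.2, hU'.1.isCompact⟩

/-- This is where the Esakia condition enters: the preimage of a clopen set of the patch space is
its down-closure in `X`. -/
theorem isSpectralDistributor_orderIn (hX : IsEsakia X) : IsSpectralDistributor (orderIn X) := by
  rw [isSpectralDistributor_iff]
  refine ⟨fun x => isClosed_closure.preimage (continuous_ofTopology X), fun A hA hAc => ?_⟩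
  have h : {x | ∃ w ∈ A, orderIn X x w} = downClosure (WithTopology.toTopology _ ⁻¹' A) := by
    ext x
    constructor
    · rintro ⟨w, hw, h⟩
      exact ⟨_, hw, h⟩
    · rintro ⟨y, hy, h⟩
      exact ⟨_, hy, h⟩
  rw [h]
  refine ⟨hX _ (WithConstructibleTopology.isOpen_iff.1 hA), ?_⟩
  refine isCompact_of_finite_subcover fun V hV hcov => ?_
  obtain ⟨t, ht⟩ := (hAc.image (continuous_ofTopology X)).elim_finite_subcover V hV <| by
    rintro _ ⟨w, hw, rfl⟩
    exact hcov ⟨_, hw, subset_closure rfl⟩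
  refine ⟨t, ?_⟩
  rintro x ⟨y, hy, hxy⟩
  obtain ⟨i, hi, hyi⟩ := Set.mem_iUnion₂.1 (ht ⟨WithTopology.toTopology _ y, hy, rfl⟩)
  exact Set.mem_iUnion₂.2 ⟨i, hi, ((underlyingOrder_iff x y).1 hxy).mem_open (hV i) hyi⟩

end WithConstructibleTopology

/-! ### The idempotent completion -/

theorem EsaDist.exists_retract (X : EsaDist.{u}) :
    ∃ S : StoneRel.{u}, Nonempty (Retract X (stoneRelToEsaDist.obj S)) := by
  let S : StoneRel.{u} := ⟨⟨WithConstructibleTopology X.obj.carrier⟩,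
    WithConstructibleTopology.isStone _⟩
  let i : X.obj ⟶ S.obj := ⟨_, WithConstructibleTopology.isSpectralDistributor_orderIn X.property⟩
  let r : S.obj ⟶ X.obj := ⟨_, WithConstructibleTopology.isSpectralDistributor_orderOut⟩
  have h : i ≫ r = 𝟙 X.obj :=
    SpecDist.Hom.ext (WithConstructibleTopology.relComp_orderIn_orderOut _)
  exact ⟨S, ⟨⟨⟨i⟩, ⟨r⟩, ObjectProperty.hom_ext _ h⟩⟩⟩

theorem StoneRel.exists_splitting (S : StoneRel.{u}) (p : S ⟶ S) (hp : p ≫ p = p) :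
    ∃ (Y : EsaDist.{u}) (i : Y ⟶ stoneRelToEsaDist.obj S) (r : stoneRelToEsaDist.obj S ⟶ Y),
      i ≫ r = 𝟙 Y ∧ r ≫ i = stoneRelToEsaDist.map p := by
  have : T2Space S.obj.carrier := S.property.2.1
  have he := p.hom.isSpectralDistributor
  have hee : relComp p.hom.rel p.hom.rel = p.hom.rel :=
    congrArg (fun q : S ⟶ S => q.hom.rel) hp
  let Y : EsaDist.{u} := ⟨⟨StoneIdempotent.Splitting he hee⟩, PrimeIdealSpace.isEsakia⟩
  let i : Y.obj ⟶ S.obj := ⟨_, StoneIdempotent.isSpectralDistributor_incl he hee⟩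
  let r : S.obj ⟶ Y.obj := ⟨_, StoneIdempotent.isSpectralDistributor_proj he hee⟩
  have hir : i ≫ r = 𝟙 Y.obj := SpecDist.Hom.ext (StoneIdempotent.relComp_incl_proj he hee)
  have hri : r ≫ i = p.hom := SpecDist.Hom.ext (StoneIdempotent.relComp_proj_incl he hee)
  exact ⟨Y, ⟨i⟩, ⟨r⟩, ObjectProperty.hom_ext _ hir, ObjectProperty.hom_ext _ hri⟩

theorem mainTheorem2 :
    ∃ e : Idempotents.Karoubi StoneRel.{u} ≌ EsaDist.{u},
      Nonempty (Idempotents.toKaroubi StoneRel.{u} ⋙ e.functor ≅ stoneRelToEsaDist.{u}) :=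
  exists_karoubi_equivalence _ StoneRel.exists_splitting EsaDist.exists_retract
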